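/- For every $\kappa>0$ there is a constant $C>0$, depending only on $\kappa$, such that the following holds. Let $L\ge 0$, let $d=d_0,d_1,\dots,d_L\ge 1$ and $d_{L+1}=1$ be integers, let $r_1,\dots,r_{L+1}>0$, and let $\mathcal W_r$ be the set of all $\mathcal W=(W_1,\dots,W_{L+1})$ with $W_s\in\mathbb R^{d_s\times d_{s-1}}$ and spectral norm $\|W_s\|_2\le r_s$. Let $$f_{\mathcal W}(x)=W_{L+1}\,\rho\big(W_L\,\rho(\cdots\rho(W_1x))\big),\qquad x\in\mathbb R^d,$$ with $\rho(t)=\max\{0,t\}$ applied coordinatewise. Let $k:\mathbb R\to\mathbb R$ and $h>0$ be such that the product kernel $K(u)=\prod_{j=1}^d h^{-1}k(u_j/h)$ is a symmetric ($K(-u)=K(u)$) probability density on $\mathbb R^d$, and assume that $\int \prod_{j=1}^d k(u_j)\,\|u\|_2\,du<c_K^1$ with $0<c_K^1<\infty$. Let $\mathcal X\subseteq\mathbb R^d$ and $B_x>0$ satisfy $\|x\|_2\le B_x$ for all $x\in\mathcal X$, let $n\ge 1$ and $S=(x_1,\dots,x_n)\in\mathcal X^n$. Put $\mathcal F^K=\{K\ast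 f_{\mathcal W}:\mathcal W\in\mathcal W_r\}$, where $K\ast f(x)=\int K(u)f(x-u)\,du$, and let $$\hat{\mathcal R}_S(\mathcal F^K)=\mathbb E_\epsilon\Big[\sup_{g\in\mathcal F^K}\frac1n\sum_{i=1}^n\epsilon_i g(x_i)\Big],$$ with independent uniform signs $\epsilon_i\in\{-1,1\}$, be its empirical Rademacher complexity. Then the convolutions $K\ast f_{\mathcal W}(x)$, $x\in\mathbb R^d$, exist, the values $g(x_i)$, $g\in\mathcal F^K$, are bounded for each $i$, and, for every $\mathcal W=(W_1,\dots,W_{L+1})\in\mathcal W_r$, with $m_s=\sqrt{\operatorname{rank}(W_s)}$, $d_w=\sum_{s=1}^{L+1}d_{s-1}d_s$, $$A=\frac{(L+1)\sqrt n\,\max_{s}\{r_sm_s\}}{\sqrt{d_w}\,\min_{s}r_s},\qquad G=\frac{B_x\prod_{s=1}^{L+1}r_s}{\sqrt n}\sqrt{d_w\log A},\qquad B_*=3h\,c_K^1+B_x,$$ one has, whenever $\log A\ge\kappa$ (with $\log 0$ read as $-\infty$), $$\hat{\mathcal R}_S(\mathcal F^K)\le C\,\frac{B_*}{B_x}\,G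 .$$ -/

import Mathlib

open MeasureTheory

namespace KCM

/-- Empirical Rademacher complexity of the class `G` on the sample `z`: the average, over all
sign vectors in `{-1, 1}ⁿ`, of the supremum of `n⁻¹ ∑ᵢ εᵢ g(zᵢ)` over `g ∈ G`. -/
noncomputable def empRademacher {Z : Type*} {n : ℕ} (G : Set (Z → ℝ)) (z : Fin n → Z) : ℝ :=
  (1 / (2 : ℝ) ^ n) * ∑ ε : Fin n → ℤˣ,
    ⨆ g : G, (1 / (n : ℝ)) * ∑ i, ((ε i : ℤ) : ℝ) * g.1 (z i)

/-- Weight matrices `W₁, …, W_{L+1}`; `W s` is the matrix that maps layer `s` to layer `s + 1`,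
the widths being `d 0, …, d (L + 1)`. -/
abbrev Weights (L : ℕ) (d : ℕ → ℕ) : Type :=
  (s : Fin (L + 1)) → Matrix (Fin (d (s + 1))) (Fin (d s)) ℝ

/-- Values of the `s`-th layer, `s ≤ L`: layer `0` is the input, and each hidden layer is the
ReLU of a weight matrix applied to the preceding layer. -/
noncomputable def hidden {L : ℕ} {d : ℕ → ℕ} (W : Weights L d)
    (x : EuclideanSpace ℝ (Fin (d 0))) : (s : ℕ) → s ≤ L → Fin (d s) → ℝ
  | 0, _ => fun j => x j
  | s + 1, hs => fun j =>
      max 0 ((W ⟨s, by omega⟩).mulVec (hidden W x s (by omega)) j)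

/-- The ReLU network `f_W` with `L` hidden layers and a single output unit. -/
noncomputable def network {L : ℕ} {d : ℕ → ℕ} (hout : d (L + 1) = 1) (W : Weights L d)
    (x : EuclideanSpace ℝ (Fin (d 0))) : ℝ :=
  (W (Fin.last L)).mulVec (hidden W x L le_rfl) ⟨0, by simp [hout]⟩

open scoped Matrix.Norms.L2Operator in
/-- The spectral norm (operator norm for the Euclidean norms) of a rectangular matrix. -/
noncomputable def opNorm2 {p q : ℕ} (A : Matrix (Fin p) (Fin q) ℝ) : ℝ := ‖A‖

/-- The weight matrices with `‖W_s‖₂ ≤ r_s` for every layer. -/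
def spectralBall {L : ℕ} (d : ℕ → ℕ) (r : Fin (L + 1) → ℝ) : Set (Weights L d) :=
  {W | ∀ s, opNorm2 (W s) ≤ r s}

/-- The spectrally normalized ReLU networks. -/
def dnnClass {L : ℕ} {d : ℕ → ℕ} (hout : d (L + 1) = 1) (r : Fin (L + 1) → ℝ) :
    Set (EuclideanSpace ℝ (Fin (d 0)) → ℝ) :=
  {f | ∃ W ∈ spectralBall d r, f = network hout W}

/-- The univariate kernel with bandwidth `h`. -/
noncomputable def scaledKernel (k : ℝ → ℝ) (h : ℝ) (u : ℝ) : ℝ := h⁻¹ * k (u / h)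

/-- The product function `u ↦ ∏ⱼ k (uⱼ)`. -/
noncomputable def productKernel {m : ℕ} (k : ℝ → ℝ) (u : EuclideanSpace ℝ (Fin m)) : ℝ :=
  ∏ j, k (u j)

/-- A symmetric (even) probability density on `ℝᵐ` with respect to Lebesgue measure. -/
structure IsSymmetricDensity {m : ℕ} (K : EuclideanSpace ℝ (Fin m) → ℝ) : Prop where
  nonneg : ∀ u, 0 ≤ K u
  integrable : Integrable K
  integral_eq_one : ∫ u, K u = 1
  even : ∀ u, K (-u) = K u

/-- The kernel-convoluted function `x ↦ ∫ K(u) f(x - u) du`. -/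
noncomputable def kernelConv {m : ℕ} (K f : EuclideanSpace ℝ (Fin m) → ℝ) :
    EuclideanSpace ℝ (Fin m) → ℝ :=
  convolution K f (ContinuousLinearMap.mul ℝ ℝ) volume

/-- The class of kernel-convoluted functions of a class `F`. -/
def convClass {m : ℕ} (K : EuclideanSpace ℝ (Fin m) → ℝ)
    (F : Set (EuclideanSpace ℝ (Fin m) → ℝ)) : Set (EuclideanSpace ℝ (Fin m) → ℝ) :=
  {g | ∃ f ∈ F, g = kernelConv K f}

/-- Total number of weights `d₀ d₁ + ⋯ + d_L d_{L+1}`. -/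
def numWeights (L : ℕ) (d : ℕ → ℕ) : ℕ := ∑ s : Fin (L + 1), d s * d (s + 1)

/-- The argument of the logarithm in the bound `G`, where `m_s = √rank(W_s)`. -/
noncomputable def logArg {L : ℕ} {d : ℕ → ℕ} (n : ℕ) (r : Fin (L + 1) → ℝ)
    (W : Weights L d) : ℝ :=
  (((L : ℝ) + 1) * √(n : ℝ) * ⨆ s, r s * √((W s).rank : ℝ)) /
    (√(numWeights L d : ℝ) * ⨅ s, r s)

/-- The bound `G` for the unconvolved class. -/
noncomputable def boundG {L : ℕ} {d : ℕ → ℕ} (n : ℕ) (Bx : ℝ) (r : Fin (L + 1) → ℝ)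
    (W : Weights L d) : ℝ :=
  (Bx * ∏ s, r s) / √(n : ℝ) * √((numWeights L d : ℝ) * Real.log (logArg n r W))

end KCM

/-! A single discretization of the weights suffices; no chaining is needed. Rescaled by the radii,
the weights fill the unit ball, for the maximum of the spectral norms, of a space of dimension
`d_w`. By volume comparison this ball has a `δ`-net of at most `(1 + 2/δ)^d_w` points
(`exists_net_spectralBall`). Since ReLU is 1-Lipschitz, moving every layer by a relative error `δ`
moves `f_W(x)` by at most `(L+1) δ ∏ r_s ‖x‖` (`abs_network_sub_network_le`).

Convolution preserves such linear growth bounds, with `‖x‖` replaced by `‖x‖ + ∫ K(u)‖u‖ du ≤ B_x +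
h c_K ≤ B_*` (`abs_kernelConv_le`). It is therefore harmless both for the size of the class and for
its dependence on the weights.

For `d_w ≤ n`, put `A₀ = (L+1)√n/√d_w`, `δ = 1/A₀` and `b = B_* ∏ r_s`. Massart's lemma on the net
gives `b (√(d_w/n) + √(2 d_w log(3A₀)/n))`. Here `A₀ ≤ A` once some weight matrix is nonzero, and
`log A ≥ κ` absorbs the first term and the factor 3. For `d_w > n` the trivial bound `b` is enough.
-/

namespace KCM

/-! ### Packing and covering of a unit ball by volume. -/

section Covering

variable {E : Type*} [NormedAddCommGroup E] [NormedSpace ℝ E] [FiniteDimensional ℝ E]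

/-- Volume bound for the packing number of the closed unit ball. -/
theorem card_le_of_separated_unitBall {δ : ℝ} (hδ : 0 < δ) (s : Finset E)
    (hs : ∀ c ∈ s, ‖c‖ ≤ 1) (hsep : ∀ c ∈ s, ∀ d ∈ s, c ≠ d → δ ≤ ‖c - d‖) :
    (s.card : ℝ) ≤ (1 + 2 / δ) ^ Module.finrank ℝ E := by
  borelize E
  let μ : Measure E := Measure.addHaar
  have hδ2 : 0 < δ / 2 := by positivity
  have hρ : 0 < 1 + δ / 2 := by positivity
  have D : Set.Pairwise (s : Set E)
      (Function.onFun Disjoint fun c => Metric.ball (c : E) (δ / 2)) := by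
    rintro c hc d hd hcd
    apply Metric.ball_disjoint_ball
    rw [dist_eq_norm, add_halves]
    exact hsep c hc d hd hcd
  -- The disjoint balls of radius `δ/2` fit into one of radius `1 + δ/2`; comparing Haar measures
  -- bounds their number.
  have hsub : (⋃ c ∈ s, Metric.ball (c : E) (δ / 2)) ⊆ Metric.ball (0 : E) (1 + δ / 2) := by
    refine Set.iUnion₂_subset fun x hx => ?_
    apply Metric.ball_subset_ball'
    rw [dist_zero_right]
    linarith [hs x hx]
  have I : (s.card : ENNReal) * ENNReal.ofReal ((δ / 2) ^ Module.finrank ℝ E) *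
        μ (Metric.ball 0 1) ≤
      ENNReal.ofReal ((1 + δ / 2) ^ Module.finrank ℝ E) * μ (Metric.ball 0 1) :=
    calc
      _ = μ (⋃ c ∈ s, Metric.ball (c : E) (δ / 2)) := by
        rw [measure_biUnion_finset D fun c _ => measurableSet_ball]
        simp only [μ.addHaar_ball_of_pos _ hδ2]
        simp only [Finset.sum_const, nsmul_eq_mul, mul_assoc]
      _ ≤ μ (Metric.ball (0 : E) (1 + δ / 2)) := measure_mono hsub
      _ = _ := by simp only [μ.addHaar_ball_of_pos _ hρ]
  have J := (ENNReal.mul_le_mul_iff_left (Metric.measure_ball_pos μ _ zero_lt_one).ne'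
    measure_ball_lt_top.ne).1 I
  have K := ENNReal.toReal_le_of_le_ofReal (pow_nonneg hρ.le _) J
  rw [ENNReal.toReal_mul, ENNReal.toReal_natCast, ENNReal.toReal_ofReal (by positivity)] at K
  have e : (1 + 2 / δ) ^ Module.finrank ℝ E =
      (1 + δ / 2) ^ Module.finrank ℝ E / (δ / 2) ^ Module.finrank ℝ E := by
    rw [← div_pow]
    congr 1
    field_simp
    ring
  rw [e, le_div_iff₀ (by positivity)]
  exact K

/-- The closed unit ball has a `δ`-net of at most `(1 + 2 / δ) ^ dim` of its points. -/
theorem exists_net_unitBall {δ : ℝ} (hδ : 0 < δ) :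
    ∃ t : Finset E, (∀ c ∈ t, ‖c‖ ≤ 1) ∧
      (t.card : ℝ) ≤ (1 + 2 / δ) ^ Module.finrank ℝ E ∧
      ∀ x : E, ‖x‖ ≤ 1 → ∃ c ∈ t, ‖x - c‖ ≤ δ := by
  classical
  let P : Finset E → Prop := fun t =>
    (∀ c ∈ t, ‖c‖ ≤ 1) ∧ ∀ c ∈ t, ∀ d ∈ t, c ≠ d → δ ≤ ‖c - d‖
  have hbdd : BddAbove {m : ℕ | ∃ t, P t ∧ t.card = m} := by
    refine ⟨⌈(1 + 2 / δ) ^ Module.finrank ℝ E⌉₊, ?_⟩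
    rintro m ⟨t, ht, rfl⟩
    exact_mod_cast (card_le_of_separated_unitBall hδ t ht.1 ht.2).trans (Nat.le_ceil _)
  have hne : {m : ℕ | ∃ t, P t ∧ t.card = m}.Nonempty := ⟨0, ∅, by simp [P], by simp⟩
  -- A separated set of maximal cardinality is a net: an uncovered point could be added to it.
  obtain ⟨t, ht, hcard⟩ := Nat.sSup_mem hne hbdd
  refine ⟨t, ht.1, card_le_of_separated_unitBall hδ t ht.1 ht.2, fun x hx => ?_⟩
  by_contra! hfar
  have hxt : x ∉ t := fun hmem => by
    have := hfar x hmem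
    simp at this
    linarith
  have hP : P (insert x t) := by
    refine ⟨fun c hc => ?_, fun c hc d hd hcd => ?_⟩
    · rcases Finset.mem_insert.1 hc with rfl | hc
      exacts [hx, ht.1 c hc]
    · rcases Finset.mem_insert.1 hc with rfl | hc' <;>
        rcases Finset.mem_insert.1 hd with rfl | hd'
      · exact absurd rfl hcd
      · exact (hfar d hd').le
      · rw [norm_sub_rev]
        exact (hfar c hc').le
      · exact ht.2 c hc' d hd' hcd
  have := le_csSup hbdd ⟨_, hP, rfl⟩
  rw [Finset.card_insert_of_notMem hxt, ← hcard] at this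
  omega

end Covering

/-! ### Rademacher averages and Massart's lemma. -/

section Rademacher

/-- Moment generating function of a Rademacher sum. -/
theorem sum_exp_rademacher_le {n : ℕ} (a : Fin n → ℝ) {b : ℝ} (hb : ∀ i, |a i| ≤ b) :
    ∑ ε : Fin n → ℤˣ, Real.exp (∑ i, ((ε i : ℤ) : ℝ) * a i) ≤
      2 ^ n * Real.exp (n * (b ^ 2 / 2)) := by
  have h1 : ∑ ε : Fin n → ℤˣ, Real.exp (∑ i, ((ε i : ℤ) : ℝ) * a i) =
      ∏ i, ∑ e : ℤˣ, Real.exp (((e : ℤ) : ℝ) * a i) := by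
    rw [Fintype.prod_sum]
    simp_rw [Real.exp_sum]
  have h2 : ∀ i, ∑ e : ℤˣ, Real.exp (((e : ℤ) : ℝ) * a i) ≤ 2 * Real.exp (b ^ 2 / 2) := by
    intro i
    have : ∑ e : ℤˣ, Real.exp (((e : ℤ) : ℝ) * a i) = 2 * Real.cosh (a i) := by
      rw [Real.cosh_eq, UnitsInt.univ]
      simp
      ring
    rw [this]
    gcongr
    refine (Real.cosh_le_exp_half_sq _).trans (Real.exp_le_exp.2 ?_)
    have := sq_le_sq' (abs_le.1 (hb i)).1 (abs_le.1 (hb i)).2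
    linarith
  rw [h1]
  calc _ ≤ ∏ _i : Fin n, 2 * Real.exp (b ^ 2 / 2) :=
        Finset.prod_le_prod (fun i _ => Finset.sum_nonneg fun e _ => (Real.exp_pos _).le)
          fun i _ => h2 i
    _ = _ := by
        rw [Finset.prod_const, Finset.card_univ, Fintype.card_fin, mul_pow, Real.exp_nat_mul]

variable {Z : Type*} {n : ℕ} {G : Set (Z → ℝ)} {z : Fin n → Z}

theorem empRademacher_le_of_forall (hG : G.Nonempty) (F : (Fin n → ℤˣ) → ℝ) {R : ℝ}
    (hF : ∀ ε, ∀ g ∈ G, (1 / (n : ℝ)) * ∑ i, ((ε i : ℤ) : ℝ) * g (z i) ≤ F ε)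
    (hR : ∑ ε, F ε ≤ 2 ^ n * R) : empRademacher G z ≤ R := by
  have : Nonempty G := hG.to_subtype
  unfold empRademacher
  rw [one_div, inv_mul_le_iff₀ (by positivity)]
  exact (Finset.sum_le_sum fun ε _ => ciSup_le fun g => hF ε g.1 g.2).trans hR

theorem abs_sign_mul (e : ℤˣ) (x : ℝ) : |((e : ℤ) : ℝ) * x| = |x| := by
  rcases Int.units_eq_one_or e with rfl | rfl <;> simp

theorem mean_sign_mul_le (hn : 0 < n) (ε : Fin n → ℤˣ) (a : Fin n → ℝ) {b : ℝ}
    (hb : ∀ i, |a i| ≤ b) : (1 / (n : ℝ)) * ∑ i, ((ε i : ℤ) : ℝ) * a i ≤ b := by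
  have hn' : (0 : ℝ) < n := by exact_mod_cast hn
  rw [one_div, inv_mul_le_iff₀ hn']
  calc _ ≤ ∑ _i : Fin n, b := Finset.sum_le_sum fun i _ =>
        (le_abs_self _).trans ((abs_sign_mul _ _).trans_le (hb i))
    _ = n * b := by simp

theorem empRademacher_le_of_bounded (hn : 0 < n) (hG : G.Nonempty) {b : ℝ}
    (hb : ∀ g ∈ G, ∀ i, |g (z i)| ≤ b) : empRademacher G z ≤ b :=
  empRademacher_le_of_forall hG (fun _ => b)
    (fun ε g hg => mean_sign_mul_le hn ε _ (hb g hg)) (by simp)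

/-- One-step discretization: Massart's finite class lemma applied to a net. -/
theorem empRademacher_le_of_net (hn : 0 < n) (hG : G.Nonempty) (t : Finset (Z → ℝ)) {b η ℓ : ℝ}
    (hb : 0 < b) (hℓ : 0 < ℓ) (ht : ∀ g ∈ t, ∀ i, |g (z i)| ≤ b)
    (hnet : ∀ g ∈ G, ∃ g' ∈ t, ∀ i, |g (z i) - g' (z i)| ≤ η)
    (hcard : (t.card : ℝ) ≤ Real.exp ℓ) :
    empRademacher G z ≤ η + b * √(2 * ℓ / n) := by
  have hn' : (0 : ℝ) < n := by exact_mod_cast hn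
  -- This `c` minimizes `ℓ/(nc) + c b²/2`. It makes `n (cb)²/2 = ℓ`, so the exponential sum over the
  -- net has mean at most `M = exp(2ℓ)`.
  set c : ℝ := √(2 * ℓ / n) / b with hc
  have hcpos : 0 < c := by positivity
  have hcsq : (c * b) ^ 2 = 2 * ℓ / n := by
    rw [hc, div_mul_cancel₀ _ hb.ne', Real.sq_sqrt (by positivity)]
  set M : ℝ := Real.exp (2 * ℓ) with hM
  set T : (Fin n → ℤˣ) → ℝ := fun ε => ∑ g ∈ t, Real.exp (∑ i, ((ε i : ℤ) : ℝ) * (c * g (z i)))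
    with hT
  have hTsum : ∑ ε, T ε ≤ 2 ^ n * M := by
    rw [hT, Finset.sum_comm]
    calc _ ≤ ∑ g ∈ t, 2 ^ n * Real.exp (n * ((c * b) ^ 2 / 2)) :=
          Finset.sum_le_sum fun g hg => sum_exp_rademacher_le _ fun i => by
            rw [abs_mul, abs_of_pos hcpos]
            exact mul_le_mul_of_nonneg_left (ht g hg i) hcpos.le
      _ = t.card * (2 ^ n * Real.exp ℓ) := by
          rw [Finset.sum_const, nsmul_eq_mul, hcsq]
          congr 3
          field_simp
      _ ≤ Real.exp ℓ * (2 ^ n * Real.exp ℓ) := by gcongr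
      _ = 2 ^ n * M := by rw [hM, two_mul, Real.exp_add]; ring
  -- In place of Jensen's inequality, `y ≤ exp(y - 2ℓ) - 1 + 2ℓ` is used for each sign vector. As
  -- `T` has mean at most `M`, averaging leaves `2ℓ`.
  refine empRademacher_le_of_forall hG
    (fun ε => η + (1 / (n * c)) * (T ε / M - 1 + 2 * ℓ)) (fun ε g hg => ?_) ?_
  · obtain ⟨g', hg', hd⟩ := hnet g hg
    have h1 : (1 / (n : ℝ)) * ∑ i, ((ε i : ℤ) : ℝ) * (g (z i) - g' (z i)) ≤ η :=
      mean_sign_mul_le hn ε _ hd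
    have h2 : ∑ i, ((ε i : ℤ) : ℝ) * (c * g' (z i)) ≤ T ε / M - 1 + 2 * ℓ := by
      have h3 : Real.exp (∑ i, ((ε i : ℤ) : ℝ) * (c * g' (z i))) ≤ T ε :=
        Finset.single_le_sum (f := fun g : Z → ℝ =>
          Real.exp (∑ i, ((ε i : ℤ) : ℝ) * (c * g (z i)))) (fun _ _ => (Real.exp_pos _).le) hg'
      have h4 := Real.add_one_le_exp (∑ i, ((ε i : ℤ) : ℝ) * (c * g' (z i)) - 2 * ℓ)
      rw [Real.exp_sub] at h4
      have h5 := div_le_div_of_nonneg_right h3 (Real.exp_pos (2 * ℓ)).le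
      linarith
    have h6 : (1 / (n : ℝ)) * ∑ i, ((ε i : ℤ) : ℝ) * g (z i) =
        (1 / (n : ℝ)) * ∑ i, ((ε i : ℤ) : ℝ) * (g (z i) - g' (z i)) +
          (1 / (n * c)) * ∑ i, ((ε i : ℤ) : ℝ) * (c * g' (z i)) := by
      have e1 : ∑ i, ((ε i : ℤ) : ℝ) * (c * g' (z i)) =
          c * ∑ i, ((ε i : ℤ) : ℝ) * g' (z i) := by
        rw [Finset.mul_sum]
        exact Finset.sum_congr rfl fun i _ => by ring
      rw [e1]
      simp_rw [mul_sub, Finset.sum_sub_distrib]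
      field_simp
      ring
    rw [h6]
    gcongr
  · have hval : (1 / (n * c)) * (2 * ℓ) = b * √(2 * ℓ / n) := by
      have h7 : √(2 * ℓ / n) * √(2 * ℓ / n) = 2 * ℓ / n := Real.mul_self_sqrt (by positivity)
      have h8 : 0 < √(2 * ℓ / n) := by positivity
      rw [hc, one_div, inv_mul_eq_iff_eq_mul₀ (by positivity)]
      calc 2 * ℓ = n * (√(2 * ℓ / n) * √(2 * ℓ / n)) := by
            rw [h7]
            field_simp
        _ = _ := by field_simp
    have hMpos : 0 < M := Real.exp_pos _
    simp_rw [Finset.sum_add_distrib, ← Finset.mul_sum, Finset.sum_add_distrib,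
      Finset.sum_sub_distrib, ← Finset.sum_div]
    simp only [Finset.sum_const, Finset.card_univ, Fintype.card_pi, Fintype.card_units_int,
      Finset.prod_const, Fintype.card_fin, nsmul_eq_mul, Nat.cast_pow, Nat.cast_ofNat, mul_one]
    rw [← hval]
    have h10 : (∑ ε, T ε) / M ≤ 2 ^ n := by
      rw [div_le_iff₀ hMpos]
      exact hTsum
    have h11 : 0 < 1 / (n * c) := by positivity
    have := mul_le_mul_of_nonneg_left
      (show (∑ ε, T ε) / M - 2 ^ n + 2 ^ n * (2 * ℓ) ≤ 2 ^ n * (2 * ℓ) by linarith) h11.le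
    linarith

end Rademacher

/-! ### Size, weight dependence and nets of ReLU networks. -/

section Network

variable {L : ℕ} {d : ℕ → ℕ}

theorem opNorm2_smul {p q : ℕ} (a : ℝ) (A : Matrix (Fin p) (Fin q) ℝ) :
    opNorm2 (a • A) = |a| * opNorm2 A := by
  open scoped Matrix.Norms.L2Operator in
  exact norm_smul a A

theorem opNorm2_nonneg {p q : ℕ} (A : Matrix (Fin p) (Fin q) ℝ) : 0 ≤ opNorm2 A := by
  open scoped Matrix.Norms.L2Operator in
  exact norm_nonneg A

theorem opNorm2_zero {p q : ℕ} : opNorm2 (0 : Matrix (Fin p) (Fin q) ℝ) = 0 := by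
  open scoped Matrix.Norms.L2Operator in
  exact norm_zero

theorem norm_mulVec_le {p q : ℕ} (A : Matrix (Fin p) (Fin q) ℝ) (v : Fin q → ℝ) :
    ‖WithLp.toLp 2 (A.mulVec v)‖ ≤ opNorm2 A * ‖WithLp.toLp 2 v‖ := by
  open scoped Matrix.Norms.L2Operator in
  exact Matrix.l2_opNorm_mulVec A (WithLp.toLp 2 v)

theorem norm_relu_sub_relu_le {p : ℕ} (a b : Fin p → ℝ) :
    ‖WithLp.toLp 2 (fun j => max 0 (a j)) - WithLp.toLp 2 (fun j => max 0 (b j))‖ ≤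
      ‖WithLp.toLp 2 a - WithLp.toLp 2 b‖ := by
  rw [EuclideanSpace.norm_eq, EuclideanSpace.norm_eq]
  refine Real.sqrt_le_sqrt (Finset.sum_le_sum fun j _ => ?_)
  simp only [PiLp.sub_apply, Real.norm_eq_abs, sq_abs]
  rw [sq_le_sq]
  simpa [max_comm] using abs_max_sub_max_le_abs (a j) (b j) 0

theorem norm_relu_le {p : ℕ} (a : Fin p → ℝ) :
    ‖WithLp.toLp 2 (fun j => max 0 (a j))‖ ≤ ‖WithLp.toLp 2 a‖ := by
  have h := norm_relu_sub_relu_le a 0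
  simpa [← Pi.zero_def] using h

/-- Splits `Av - Bw = A(v - w) + (A - B)w`: inherited error plus error of the current layer. -/
theorem norm_mulVec_sub_mulVec_le {p q : ℕ} (A B : Matrix (Fin p) (Fin q) ℝ) (v w : Fin q → ℝ) :
    ‖WithLp.toLp 2 (A.mulVec v) - WithLp.toLp 2 (B.mulVec w)‖ ≤
      opNorm2 A * ‖WithLp.toLp 2 v - WithLp.toLp 2 w‖ + opNorm2 (A - B) * ‖WithLp.toLp 2 w‖ := by
  have e : WithLp.toLp 2 (A.mulVec v) - WithLp.toLp 2 (B.mulVec w) =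
      WithLp.toLp 2 (A.mulVec (v - w)) + WithLp.toLp 2 ((A - B).mulVec w) := by
    rw [Matrix.mulVec_sub, Matrix.sub_mulVec, ← WithLp.toLp_sub, ← WithLp.toLp_add]
    congr 1
    abel
  rw [e]
  exact (norm_add_le _ _).trans (add_le_add (norm_mulVec_le _ _) (norm_mulVec_le _ _))

/-- The radii as a sequence, continued by `1`. -/
noncomputable def radius (r : Fin (L + 1) → ℝ) (i : ℕ) : ℝ :=
  if h : i < L + 1 then r ⟨i, h⟩ else 1

theorem radius_pos {r : Fin (L + 1) → ℝ} (hr : ∀ s, 0 < r s) (i : ℕ) : 0 < radius r i := by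
  unfold radius
  split_ifs
  exacts [hr _, one_pos]

theorem prod_radius (r : Fin (L + 1) → ℝ) :
    ∏ i ∈ Finset.range (L + 1), radius r i = ∏ s, r s := by
  rw [Finset.prod_range]
  exact Finset.prod_congr rfl fun s _ => by rw [radius, dif_pos s.is_lt]

theorem opNorm2_le_radius {r : Fin (L + 1) → ℝ} {W : Weights L d} (hW : W ∈ spectralBall d r)
    {s : ℕ} (hs : s < L + 1) : opNorm2 (W ⟨s, hs⟩) ≤ radius r s := by
  rw [radius, dif_pos hs]
  exact hW _

theorem norm_hidden_le {r : Fin (L + 1) → ℝ} (hr : ∀ s, 0 < r s) {W : Weights L d}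
    (hW : W ∈ spectralBall d r) (x : EuclideanSpace ℝ (Fin (d 0))) (s : ℕ) (hs : s ≤ L) :
    ‖WithLp.toLp 2 (hidden W x s hs)‖ ≤ (∏ i ∈ Finset.range s, radius r i) * ‖x‖ := by
  induction s with
  | zero => simp [hidden]
  | succ s ih =>
    have hs' : s < L + 1 := by omega
    calc _ ≤ ‖WithLp.toLp 2 ((W ⟨s, hs'⟩).mulVec (hidden W x s (by omega)))‖ := by
          rw [hidden]
          exact norm_relu_le _
      _ ≤ opNorm2 (W ⟨s, hs'⟩) * ‖WithLp.toLp 2 (hidden W x s (by omega))‖ := norm_mulVec_le _ _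
      _ ≤ radius r s * ((∏ i ∈ Finset.range s, radius r i) * ‖x‖) :=
          mul_le_mul (opNorm2_le_radius hW hs') (ih _) (norm_nonneg _) (radius_pos hr s).le
      _ = _ := by rw [Finset.prod_range_succ]; ring

/-- Each layer multiplies the inherited error by at most its radius and adds one relative error `δ`,
so relative errors add up linearly in the depth. -/
theorem norm_hidden_sub_hidden_le {r : Fin (L + 1) → ℝ} (hr : ∀ s, 0 < r s) {W V : Weights L d}
    (hW : W ∈ spectralBall d r) (hV : V ∈ spectralBall d r) {δ : ℝ}
    (hWV : ∀ s, opNorm2 (W s - V s) ≤ δ * r s)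
    (x : EuclideanSpace ℝ (Fin (d 0))) (s : ℕ) (hs : s ≤ L) :
    ‖WithLp.toLp 2 (hidden W x s hs) - WithLp.toLp 2 (hidden V x s hs)‖ ≤
      s * δ * ((∏ i ∈ Finset.range s, radius r i) * ‖x‖) := by
  induction s with
  | zero => simp [hidden]
  | succ s ih =>
    have hs' : s < L + 1 := by omega
    have hδ : opNorm2 (W ⟨s, hs'⟩ - V ⟨s, hs'⟩) ≤ δ * radius r s := by
      rw [radius, dif_pos hs']
      exact hWV _
    calc _ ≤ ‖WithLp.toLp 2 ((W ⟨s, hs'⟩).mulVec (hidden W x s (by omega))) -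
            WithLp.toLp 2 ((V ⟨s, hs'⟩).mulVec (hidden V x s (by omega)))‖ := by
          rw [hidden, hidden]
          exact norm_relu_sub_relu_le _ _
      _ ≤ _ := norm_mulVec_sub_mulVec_le _ _ _ _
      _ ≤ radius r s * (s * δ * ((∏ i ∈ Finset.range s, radius r i) * ‖x‖)) +
            δ * radius r s * ((∏ i ∈ Finset.range s, radius r i) * ‖x‖) :=
          add_le_add
            (mul_le_mul (opNorm2_le_radius hW hs') (ih _) (norm_nonneg _) (radius_pos hr s).le)
            (mul_le_mul hδ (norm_hidden_le hr hV x s _) (norm_nonneg _)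
              ((opNorm2_nonneg _).trans hδ))
      _ = _ := by rw [Finset.prod_range_succ]; push_cast; ring

theorem abs_network_le (hout : d (L + 1) = 1) {r : Fin (L + 1) → ℝ} (hr : ∀ s, 0 < r s)
    {W : Weights L d} (hW : W ∈ spectralBall d r) (x : EuclideanSpace ℝ (Fin (d 0))) :
    |network hout W x| ≤ (∏ s, r s) * ‖x‖ := by
  calc _ ≤ ‖WithLp.toLp 2 ((W (Fin.last L)).mulVec (hidden W x L le_rfl))‖ :=
        PiLp.norm_apply_le (WithLp.toLp 2 ((W (Fin.last L)).mulVec (hidden W x L le_rfl))) _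
    _ ≤ opNorm2 (W (Fin.last L)) * ‖WithLp.toLp 2 (hidden W x L le_rfl)‖ := norm_mulVec_le _ _
    _ ≤ radius r L * ((∏ i ∈ Finset.range L, radius r i) * ‖x‖) :=
        mul_le_mul (opNorm2_le_radius hW L.lt_succ_self) (norm_hidden_le hr hW x L _)
          (norm_nonneg _) (radius_pos hr L).le
    _ = _ := by rw [← prod_radius, Finset.prod_range_succ]; ring

theorem abs_network_sub_network_le (hout : d (L + 1) = 1) {r : Fin (L + 1) → ℝ}
    (hr : ∀ s, 0 < r s) {W V : Weights L d} (hW : W ∈ spectralBall d r)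
    (hV : V ∈ spectralBall d r) {δ : ℝ} (hWV : ∀ s, opNorm2 (W s - V s) ≤ δ * r s)
    (x : EuclideanSpace ℝ (Fin (d 0))) :
    |network hout W x - network hout V x| ≤ (L + 1) * δ * (∏ s, r s) * ‖x‖ := by
  have hδ : opNorm2 (W (Fin.last L) - V (Fin.last L)) ≤ δ * radius r L := by
    rw [radius, dif_pos L.lt_succ_self]
    exact hWV _
  calc _ ≤ ‖WithLp.toLp 2 ((W (Fin.last L)).mulVec (hidden W x L le_rfl)) -
          WithLp.toLp 2 ((V (Fin.last L)).mulVec (hidden V x L le_rfl))‖ :=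
        PiLp.norm_apply_le (WithLp.toLp 2 ((W (Fin.last L)).mulVec (hidden W x L le_rfl)) -
          WithLp.toLp 2 ((V (Fin.last L)).mulVec (hidden V x L le_rfl))) _
    _ ≤ _ := norm_mulVec_sub_mulVec_le _ _ _ _
    _ ≤ radius r L * (L * δ * ((∏ i ∈ Finset.range L, radius r i) * ‖x‖)) +
          δ * radius r L * ((∏ i ∈ Finset.range L, radius r i) * ‖x‖) :=
        add_le_add
          (mul_le_mul (opNorm2_le_radius hW L.lt_succ_self)
            (norm_hidden_sub_hidden_le hr hW hV hWV x L _) (norm_nonneg _) (radius_pos hr L).le)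
          (mul_le_mul hδ (norm_hidden_le hr hV x L _) (norm_nonneg _)
            ((opNorm2_nonneg _).trans hδ))
    _ = _ := by rw [← prod_radius, Finset.prod_range_succ]; ring

theorem continuous_hidden (W : Weights L d) (s : ℕ) (hs : s ≤ L) :
    Continuous fun x : EuclideanSpace ℝ (Fin (d 0)) => hidden W x s hs := by
  induction s with
  | zero =>
    simp only [hidden]
    fun_prop
  | succ s ih =>
    simp only [hidden]
    refine continuous_pi fun j => continuous_const.max ?_
    exact (continuous_apply j).comp (continuous_const.matrix_mulVec (ih (by omega)))

theorem continuous_network (hout : d (L + 1) = 1) (W : Weights L d) :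
    Continuous (network hout W) :=
  (continuous_apply _).comp (continuous_const.matrix_mulVec (continuous_hidden W L le_rfl))

theorem finrank_weights : Module.finrank ℝ (Weights L d) = numWeights L d := by
  rw [Module.finrank_pi_fintype, numWeights]
  exact Finset.sum_congr rfl fun s _ => by simp [Module.finrank_matrix, mul_comm]

/-- A net of the spectral ball, relative to the radii of the layers. -/
theorem exists_net_spectralBall {r : Fin (L + 1) → ℝ} (hr : ∀ s, 0 < r s) {δ : ℝ} (hδ : 0 < δ) :
    ∃ t : Finset (Weights L d), (∀ V ∈ t, V ∈ spectralBall d r) ∧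
      (t.card : ℝ) ≤ (1 + 2 / δ) ^ numWeights L d ∧
      ∀ W ∈ spectralBall d r, ∃ V ∈ t, ∀ s, opNorm2 (W s - V s) ≤ δ * r s := by
  classical
  -- With the spectral norm on each factor, the norm of the product space is the maximum over
  -- layers, and dividing by the radii turns the spectral ball into the unit ball.
  open scoped Matrix.Norms.L2Operator in
  obtain ⟨t, ht, hcard, hnet⟩ := exists_net_unitBall (E := Weights L d) hδ
  let scale : Weights L d → Weights L d := fun V s => r s • V s
  refine ⟨t.image scale, ?_, ?_, ?_⟩
  · intro V hV
    obtain ⟨c, hc, rfl⟩ := Finset.mem_image.1 hV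
    intro s
    have h1 : opNorm2 (c s) ≤ 1 := (norm_le_pi_norm c s).trans (ht c hc)
    change opNorm2 (r s • c s) ≤ r s
    rw [opNorm2_smul, abs_of_pos (hr s)]
    exact mul_le_of_le_one_right (hr s).le h1
  · rw [finrank_weights] at hcard
    exact (Nat.cast_le.2 Finset.card_image_le).trans hcard
  · intro W hW
    obtain ⟨c, hc, hd⟩ := hnet (fun s => (r s)⁻¹ • W s) <| by
      refine (pi_norm_le_iff_of_nonneg zero_le_one).2 fun s => ?_
      change opNorm2 ((r s)⁻¹ • W s) ≤ 1
      rw [opNorm2_smul, abs_of_pos (inv_pos.2 (hr s)), inv_mul_le_iff₀ (hr s), mul_one]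
      exact hW s
    refine ⟨scale c, Finset.mem_image_of_mem _ hc, fun s => ?_⟩
    have h1 : opNorm2 ((r s)⁻¹ • W s - c s) ≤ δ :=
      (norm_le_pi_norm ((fun s => (r s)⁻¹ • W s : Weights L d) - c) s).trans hd
    have e : W s - scale c s = r s • ((r s)⁻¹ • W s - c s) := by
      rw [smul_sub, smul_inv_smul₀ (hr s).ne']
    rw [e, opNorm2_smul, abs_of_pos (hr s), mul_comm]
    exact mul_le_mul_of_nonneg_right h1 (hr s).le

end Network

/-! ### Kernel moments and convolution of functions of linear growth. -/

section Convolution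

variable {m : ℕ} {K f g : EuclideanSpace ℝ (Fin m) → ℝ} {M : ℝ}

theorem productKernel_scaledKernel (k : ℝ → ℝ) {h : ℝ} (u : EuclideanSpace ℝ (Fin m)) :
    productKernel (scaledKernel k h) u = (h⁻¹) ^ m * productKernel k (h⁻¹ • u) := by
  simp only [productKernel, scaledKernel, Finset.prod_mul_distrib, Finset.prod_const,
    Finset.card_univ, Fintype.card_fin, PiLp.smul_apply, smul_eq_mul, div_eq_inv_mul]

/-- Prepares the substitution `u = hv`, under which the first moment gains a factor `h`. -/
theorem scaledKernel_mul_norm (k : ℝ → ℝ) {h : ℝ} (hh : 0 < h) :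
    (fun u : EuclideanSpace ℝ (Fin m) => productKernel (scaledKernel k h) u * ‖u‖) =
      fun u => ((h⁻¹) ^ m * h) * (productKernel k (h⁻¹ • u) * ‖h⁻¹ • u‖) := by
  funext u
  rw [productKernel_scaledKernel, norm_smul, Real.norm_of_nonneg (inv_pos.2 hh).le]
  field_simp

theorem integrable_scaledKernel_mul_norm {k : ℝ → ℝ} {h : ℝ} (hh : 0 < h)
    (hk : Integrable fun u : EuclideanSpace ℝ (Fin m) => productKernel k u * ‖u‖) :
    Integrable fun u : EuclideanSpace ℝ (Fin m) =>
      productKernel (scaledKernel k h) u * ‖u‖ := by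
  rw [scaledKernel_mul_norm k hh]
  exact (hk.comp_smul (inv_pos.2 hh).ne').const_mul _

theorem integral_scaledKernel_mul_norm (k : ℝ → ℝ) {h : ℝ} (hh : 0 < h) :
    ∫ u : EuclideanSpace ℝ (Fin m), productKernel (scaledKernel k h) u * ‖u‖ =
      h * ∫ u : EuclideanSpace ℝ (Fin m), productKernel k u * ‖u‖ := by
  rw [scaledKernel_mul_norm k hh, integral_const_mul,
    Measure.integral_comp_inv_smul volume (fun u => productKernel k u * ‖u‖) h,
    finrank_euclideanSpace_fin, abs_of_pos (pow_pos hh m), smul_eq_mul, inv_pow]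
  field_simp

theorem integrable_kernel_mul_shift (hK : IsSymmetricDensity K)
    (hK1 : Integrable fun u => K u * ‖u‖) (hf : Continuous f) (hM : ∀ y, |f y| ≤ M * ‖y‖)
    (hM0 : 0 ≤ M) (x : EuclideanSpace ℝ (Fin m)) : Integrable fun u => K u * f (x - u) := by
  refine Integrable.mono' (((hK.integrable.const_mul ‖x‖).add hK1).const_mul M)
    (hK.integrable.aestronglyMeasurable.mul
      (hf.comp (continuous_const.sub continuous_id)).aestronglyMeasurable)
    (Filter.Eventually.of_forall fun u => ?_)
  rw [Real.norm_eq_abs, abs_mul, abs_of_nonneg (hK.nonneg u)]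
  calc _ ≤ K u * (M * (‖x‖ + ‖u‖)) := mul_le_mul_of_nonneg_left
        ((hM _).trans (mul_le_mul_of_nonneg_left (norm_sub_le _ _) hM0)) (hK.nonneg u)
    _ = _ := by simp only [Pi.add_apply]; ring

theorem kernelConv_apply (K f : EuclideanSpace ℝ (Fin m) → ℝ) (x : EuclideanSpace ℝ (Fin m)) :
    kernelConv K f x = ∫ u, K u * f (x - u) := by
  simp [kernelConv, convolution]

/-- Follows from `‖x - u‖ ≤ ‖x‖ + ‖u‖` and unit mass of `K`. It serves for networks and for
differences of networks. -/
theorem abs_kernelConv_le (hK : IsSymmetricDensity K)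
    (hK1 : Integrable fun u => K u * ‖u‖) (hM : ∀ y, |f y| ≤ M * ‖y‖)
    (hM0 : 0 ≤ M) (x : EuclideanSpace ℝ (Fin m)) :
    |kernelConv K f x| ≤ M * (‖x‖ + ∫ u, K u * ‖u‖) := by
  have e : M * (‖x‖ + ∫ u, K u * ‖u‖) = ∫ u, M * (‖x‖ * K u + K u * ‖u‖) := by
    rw [integral_const_mul, integral_add (hK.integrable.const_mul _) hK1, integral_const_mul,
      hK.integral_eq_one, mul_one]
  rw [kernelConv_apply, e, ← Real.norm_eq_abs]
  refine norm_integral_le_of_norm_le (((hK.integrable.const_mul ‖x‖).add hK1).const_mul M)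
    (Filter.Eventually.of_forall fun u => ?_)
  rw [Real.norm_eq_abs, abs_mul, abs_of_nonneg (hK.nonneg u)]
  calc _ ≤ K u * (M * (‖x‖ + ‖u‖)) := mul_le_mul_of_nonneg_left
        ((hM _).trans (mul_le_mul_of_nonneg_left (norm_sub_le _ _) hM0)) (hK.nonneg u)
    _ = _ := by ring

theorem kernelConv_sub {x : EuclideanSpace ℝ (Fin m)}
    (hf : Integrable fun u => K u * f (x - u)) (hg : Integrable fun u => K u * g (x - u)) :
    kernelConv K f x - kernelConv K g x = kernelConv K (fun y => f y - g y) x := by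
  simp only [kernelConv_apply]
  rw [← integral_sub hf hg]
  simp only [mul_sub]

end Convolution

/-! ### Combining the net, the convolution and the quantity `A`. -/

variable {L : ℕ} {d : ℕ → ℕ}

theorem zero_mem_spectralBall {r : Fin (L + 1) → ℝ} (hr : ∀ s, 0 < r s) :
    (fun _ => 0) ∈ spectralBall d r := fun s => opNorm2_zero.trans_le (hr s).le

theorem numWeights_pos (hd : ∀ s ≤ L + 1, 0 < d s) : 0 < numWeights L d :=
  Finset.sum_pos (fun s _ => Nat.mul_pos (hd _ (by omega)) (hd _ (by omega)))
    ⟨0, Finset.mem_univ _⟩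

/-- Some weight matrix is nonzero as soon as `log A > 0`, and then `A ≥ (L + 1) √n / √d_w`. -/
theorem le_logArg (n : ℕ) {r : Fin (L + 1) → ℝ} (hr : ∀ s, 0 < r s) {W : Weights L d}
    (hlog : 0 < Real.log (logArg n r W)) :
    ((L : ℝ) + 1) * √n / √(numWeights L d) ≤ logArg n r W := by
  have hinf : 0 < ⨅ s, r s := by
    obtain ⟨s, hs⟩ := exists_eq_ciInf_of_finite (f := r)
    exact hs ▸ hr s
  have hbdd : BddAbove (Set.range fun s => r s * √((W s).rank : ℝ)) :=
    (Set.finite_range _).bddAbove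
  -- If all ranks vanished, `logArg` would be `0`, whose `Real.log` is `0` and not positive.
  have hex : ∃ s, (W s).rank ≠ 0 := by
    by_contra! h0
    simp [logArg, h0] at hlog
  obtain ⟨s, hs⟩ := hex
  have h1 : (1 : ℝ) ≤ √((W s).rank : ℝ) := by
    rw [Real.one_le_sqrt]
    exact_mod_cast Nat.one_le_iff_ne_zero.2 hs
  have h2 : ⨅ s, r s ≤ ⨆ s, r s * √((W s).rank : ℝ) :=
    (ciInf_le (Set.finite_range r).bddBelow s).trans
      ((le_mul_of_one_le_right (hr s).le h1).trans (le_ciSup hbdd s))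
  calc _ = ((L : ℝ) + 1) * √n * (⨅ s, r s) / (√(numWeights L d) * ⨅ s, r s) :=
        (mul_div_mul_right _ _ hinf.ne').symm
    _ ≤ _ := by
        unfold logArg
        gcongr

theorem mul_boundG (n : ℕ) {Bx c : ℝ} (hBx : 0 < Bx) (r : Fin (L + 1) → ℝ) (W : Weights L d) :
    c / Bx * boundG n Bx r W =
      (∏ s, r s) * c * √(numWeights L d * Real.log (logArg n r W) / n) := by
  rw [boundG, Real.sqrt_div' _ n.cast_nonneg]
  field_simp

section Bound

variable {K : EuclideanSpace ℝ (Fin (d 0)) → ℝ} {r : Fin (L + 1) → ℝ} {n : ℕ}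
  {S : Fin n → EuclideanSpace ℝ (Fin (d 0))} {c : ℝ}

theorem integrable_kernel_mul_network (hout : d (L + 1) = 1) (hr : ∀ s, 0 < r s)
    (hK : IsSymmetricDensity K) (hK1 : Integrable fun u => K u * ‖u‖) {W : Weights L d}
    (hW : W ∈ spectralBall d r) (x : EuclideanSpace ℝ (Fin (d 0))) :
    Integrable fun u => K u * network hout W (x - u) :=
  integrable_kernel_mul_shift hK hK1 (continuous_network hout W) (abs_network_le hout hr hW)
    (Finset.prod_nonneg fun s _ => (hr s).le) x

theorem abs_kernelConv_network_le (hout : d (L + 1) = 1) (hr : ∀ s, 0 < r s)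
    (hK : IsSymmetricDensity K) (hK1 : Integrable fun u => K u * ‖u‖)
    (hc : ∀ i, ‖S i‖ + ∫ u, K u * ‖u‖ ≤ c) {W : Weights L d} (hW : W ∈ spectralBall d r)
    (i : Fin n) : |kernelConv K (network hout W) (S i)| ≤ (∏ s, r s) * c := by
  have hR : 0 ≤ ∏ s, r s := Finset.prod_nonneg fun s _ => (hr s).le
  exact (abs_kernelConv_le hK hK1 (abs_network_le hout hr hW) hR (S i)).trans
    (mul_le_mul_of_nonneg_left (hc i) hR)

theorem abs_kernelConv_network_sub_le (hout : d (L + 1) = 1) (hr : ∀ s, 0 < r s)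
    (hK : IsSymmetricDensity K) (hK1 : Integrable fun u => K u * ‖u‖)
    (hc : ∀ i, ‖S i‖ + ∫ u, K u * ‖u‖ ≤ c) {W V : Weights L d} (hW : W ∈ spectralBall d r)
    (hV : V ∈ spectralBall d r) {δ : ℝ} (hδ : 0 ≤ δ)
    (hWV : ∀ s, opNorm2 (W s - V s) ≤ δ * r s) (i : Fin n) :
    |kernelConv K (network hout W) (S i) - kernelConv K (network hout V) (S i)| ≤
      (L + 1) * δ * ((∏ s, r s) * c) := by
  have hR : 0 ≤ ∏ s, r s := Finset.prod_nonneg fun s _ => (hr s).le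
  rw [kernelConv_sub (integrable_kernel_mul_network hout hr hK hK1 hW _)
    (integrable_kernel_mul_network hout hr hK hK1 hV _)]
  have hM : 0 ≤ (L + 1) * δ * ∏ s, r s := by positivity
  refine (abs_kernelConv_le hK hK1 (abs_network_sub_network_le hout hr hW hV hWV) hM
    (S i)).trans ((mul_le_mul_of_nonneg_left (hc i) hM).trans_eq ?_)
  ring

theorem convClass_nonempty (hout : d (L + 1) = 1) (hr : ∀ s, 0 < r s) :
    (convClass K (dnnClass hout r)).Nonempty :=
  ⟨_, _, ⟨_, zero_mem_spectralBall hr, rfl⟩, rfl⟩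

/-- The bound from a net at scale `√(d_w / n)`, for `d_w ≤ n`. -/
theorem empRademacher_convClass_le (hd : ∀ s ≤ L + 1, 0 < d s) (hout : d (L + 1) = 1)
    (hr : ∀ s, 0 < r s) (hK : IsSymmetricDensity K) (hK1 : Integrable fun u => K u * ‖u‖)
    (hc0 : 0 < c) (hc : ∀ i, ‖S i‖ + ∫ u, K u * ‖u‖ ≤ c) (hn : numWeights L d ≤ n) :
    empRademacher (convClass K (dnnClass hout r)) S ≤
      √(numWeights L d / n) * ((∏ s, r s) * c) + (∏ s, r s) * c *
        √(2 * (numWeights L d *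
          Real.log (3 * (((L : ℝ) + 1) * √n / √(numWeights L d)))) / n) := by
  classical
  have hD0 := numWeights_pos hd
  have hn0 : 0 < n := hD0.trans_le hn
  have hD : (0 : ℝ) < numWeights L d := by exact_mod_cast hD0
  have hn' : (0 : ℝ) < n := by exact_mod_cast hn0
  have hDn : (numWeights L d : ℝ) ≤ n := by exact_mod_cast hn
  have hR : 0 < ∏ s, r s := Finset.prod_pos fun s _ => hr s
  set A : ℝ := ((L : ℝ) + 1) * √n / √(numWeights L d) with hA
  have hsD : 0 < √(numWeights L d : ℝ) := Real.sqrt_pos.2 hD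
  have hA1 : 1 ≤ A := by
    rw [hA, one_le_div hsD]
    -- Here `d_w ≤ n` enters; `1 ≤ A` later gives `1 + 2A ≤ 3A` for the cardinality.
    nlinarith [Real.sqrt_le_sqrt hDn, Real.sqrt_nonneg (n : ℝ), (L.cast_nonneg : (0 : ℝ) ≤ L)]
  have hA0 : 0 < A := by linarith
  -- The radius `A⁻¹` cancels the depth factor of the weight dependence, leaving the discretization
  -- error `√(d_w/n)`.
  have hscale : ((L : ℝ) + 1) * A⁻¹ = √(numWeights L d / n) := by
    rw [hA, Real.sqrt_div hD.le]
    have : 0 < √(n : ℝ) := Real.sqrt_pos.2 hn'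
    field_simp
  obtain ⟨t, htball, hcard, hnet⟩ := exists_net_spectralBall (d := d) hr (inv_pos.2 hA0)
  refine empRademacher_le_of_net hn0 (convClass_nonempty hout hr)
    (t.image fun V => kernelConv K (network hout V)) (by positivity)
    (mul_pos hD (Real.log_pos (by linarith))) ?_ ?_ ?_
  · intro g hg i
    obtain ⟨V, hV, rfl⟩ := Finset.mem_image.1 hg
    exact abs_kernelConv_network_le hout hr hK hK1 hc (htball V hV) i
  · rintro g ⟨f, ⟨W, hW, rfl⟩, rfl⟩
    obtain ⟨V, hV, hWV⟩ := hnet W hW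
    refine ⟨_, Finset.mem_image_of_mem _ hV, fun i => ?_⟩
    rw [← hscale]
    exact abs_kernelConv_network_sub_le hout hr hK hK1 hc hW (htball V hV)
      (inv_pos.2 hA0).le hWV i
  · rw [Real.exp_nat_mul, Real.exp_log (by linarith)]
    refine (Nat.cast_le.2 Finset.card_image_le).trans (hcard.trans ?_)
    have : 1 + 2 / A⁻¹ ≤ 3 * A := by
      rw [div_inv_eq_mul]
      linarith
    gcongr

end Bound

end KCM

/-! ### The final bound, with a constant depending only on `κ`. -/

theorem theorem2 :
    ∀ κ : ℝ, 0 < κ → ∃ C : ℝ, 0 < C ∧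
      ∀ (L : ℕ) (d : ℕ → ℕ) (_ : ∀ s ≤ L + 1, 0 < d s) (hout : d (L + 1) = 1)
        (r : Fin (L + 1) → ℝ) (_ : ∀ s, 0 < r s)
        (k : ℝ → ℝ) (h : ℝ) (_ : 0 < h)
        (K : EuclideanSpace ℝ (Fin (d 0)) → ℝ)
        (_ : K = KCM.productKernel (KCM.scaledKernel k h))
        (_ : KCM.IsSymmetricDensity K)
        (cK : ℝ) (_ : 0 < cK)
        (_ : MeasureTheory.Integrable
          (fun u : EuclideanSpace ℝ (Fin (d 0)) => KCM.productKernel k u * ‖u‖))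
        (_ : ∫ u : EuclideanSpace ℝ (Fin (d 0)), KCM.productKernel k u * ‖u‖ < cK)
        (X : Set (EuclideanSpace ℝ (Fin (d 0)))) (Bx : ℝ) (_ : 0 < Bx)
        (_ : ∀ x ∈ X, ‖x‖ ≤ Bx)
        (n : ℕ) (_ : 0 < n)
        (S : Fin n → EuclideanSpace ℝ (Fin (d 0))) (_ : ∀ i, S i ∈ X),
        -- the convolutions and the suprema in the Rademacher complexity are well defined
        (∀ f ∈ KCM.dnnClass hout r,
          MeasureTheory.ConvolutionExists K f (ContinuousLinearMap.mul ℝ ℝ)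
            MeasureTheory.volume) ∧
        (∀ i, BddAbove ((fun g : EuclideanSpace ℝ (Fin (d 0)) → ℝ => |g (S i)|) ''
          KCM.convClass K (KCM.dnnClass hout r))) ∧
        -- the bound, with the ranks of any weights of the class
        (∀ W ∈ KCM.spectralBall d r, κ ≤ Real.log (KCM.logArg n r W) →
          KCM.empRademacher (KCM.convClass K (KCM.dnnClass hout r)) S ≤
            C * ((3 * h * cK + Bx) / Bx * KCM.boundG n Bx r W)) := by
  intro κ hκ
  -- The first summand pays for the discretization error, the second for Massart's term.
  refine ⟨1 / √κ + √(2 * (1 + 2 / κ)), by positivity, ?_⟩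
  intro L d hd hout r hr k h hh K hKeq hK cK hcK hk hkc X Bx hBx hX n hn S hS
  have hK1 : Integrable fun u => K u * ‖u‖ := by
    rw [hKeq]
    exact KCM.integrable_scaledKernel_mul_norm hh hk
  have hmoment : ∫ u, K u * ‖u‖ ≤ h * cK := by
    rw [hKeq, KCM.integral_scaledKernel_mul_norm k hh]
    exact mul_le_mul_of_nonneg_left hkc.le hh.le
  have hhc : 0 < h * cK := mul_pos hh hcK
  have hc : ∀ i, ‖S i‖ + ∫ u, K u * ‖u‖ ≤ 3 * h * cK + Bx := fun i => by
    linarith [hX _ (hS i)]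
  have hc0 : 0 < 3 * h * cK + Bx := by linarith
  have hbound : ∀ g ∈ KCM.convClass K (KCM.dnnClass hout r), ∀ i,
      |g (S i)| ≤ (∏ s, r s) * (3 * h * cK + Bx) := by
    rintro g ⟨f, ⟨V, hV, rfl⟩, rfl⟩ i
    exact KCM.abs_kernelConv_network_le hout hr hK hK1 hc hV i
  refine ⟨?_, fun i => ⟨(∏ s, r s) * (3 * h * cK + Bx), ?_⟩, ?_⟩
  · rintro f ⟨V, hV, rfl⟩ x
    exact KCM.integrable_kernel_mul_network hout hr hK hK1 hV x
  · rintro y ⟨g, hg, rfl⟩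
    exact hbound g hg i
  intro W _ hlog
  rw [KCM.mul_boundG n hBx]
  set D : ℝ := (KCM.numWeights L d : ℝ) with hDdef
  set l : ℝ := Real.log (KCM.logArg n r W) with hl
  set b : ℝ := (∏ s, r s) * (3 * h * cK + Bx) with hb
  have hb0 : 0 < b := mul_pos (Finset.prod_pos fun s _ => hr s) hc0
  have hn' : (0 : ℝ) < n := by exact_mod_cast hn
  have hD : 0 < D := by
    rw [hDdef]
    exact_mod_cast KCM.numWeights_pos hd
  have hl0 : 0 < l := hκ.trans_le hlog
  have hsκ : 0 < √κ := Real.sqrt_pos.2 hκ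
  have hscale : √(D / n) ≤ 1 / √κ * √(D * l / n) := by
    rw [one_div, le_inv_mul_iff₀ hsκ, ← Real.sqrt_mul hκ.le]
    refine Real.sqrt_le_sqrt ?_
    rw [← mul_div_assoc, mul_comm κ]
    gcongr
  have hrest : 0 ≤ √(2 * (1 + 2 / κ)) * √(D * l / n) := by positivity
  -- With more weights than samples, `√(d_w/n) ≥ 1` and the trivial bound is already of the required
  -- order.
  rcases lt_or_ge n (KCM.numWeights L d) with hnD | hnD
  · have h1 : 1 ≤ √(D / n) := by
      rw [Real.one_le_sqrt, one_le_div hn', hDdef]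
      exact_mod_cast hnD.le
    calc _ ≤ b := KCM.empRademacher_le_of_bounded hn (KCM.convClass_nonempty hout hr) hbound
      _ ≤ b * ((1 / √κ + √(2 * (1 + 2 / κ))) * √(D * l / n)) :=
          le_mul_of_one_le_right hb0.le (by linarith)
      _ = _ := by ring
  · set A : ℝ := ((L : ℝ) + 1) * √n / √(KCM.numWeights L d) with hA
    have hA0 : 0 < A := by positivity
    -- The factor 3 costs `log 3 ≤ 2 ≤ (2/κ) l`, because `l ≥ κ`.
    have hlogA : Real.log (3 * A) ≤ (1 + 2 / κ) * l := by
      have h3 : Real.log 3 ≤ 2 := by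
        have := Real.log_le_sub_one_of_pos (show (0 : ℝ) < 3 by norm_num)
        linarith
      have h4 : 2 ≤ 2 / κ * l := by
        rw [div_mul_eq_mul_div, le_div_iff₀ hκ]
        linarith
      have h5 : Real.log A ≤ l := Real.log_le_log hA0 (KCM.le_logArg n hr hl0)
      rw [Real.log_mul (by norm_num) hA0.ne']
      linarith
    have hmain : √(2 * (D * Real.log (3 * A)) / n) ≤ √(2 * (1 + 2 / κ)) * √(D * l / n) := by
      rw [← Real.sqrt_mul (by positivity)]
      refine Real.sqrt_le_sqrt ?_
      calc _ ≤ 2 * (D * ((1 + 2 / κ) * l)) / n := by gcongr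
        _ = _ := by ring
    calc _ ≤ √(D / n) * b + b * √(2 * (D * Real.log (3 * A)) / n) :=
          KCM.empRademacher_convClass_le hd hout hr hK hK1 hc0 hc hnD
      _ ≤ 1 / √κ * √(D * l / n) * b + b * (√(2 * (1 + 2 / κ)) * √(D * l / n)) := by gcongr
      _ = _ := by ring
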